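/- Let $\Gamma$ be a finite graph with $v_0$ vertices and $e_0\ge 1$ edges that is balanced, i.e. $e(H)/v(H)\le e_0/v_0$ for every nonempty subgraph $H\subset\Gamma$, where $e(H),v(H)$ are the numbers of edges and vertices of $H$. Fix a probability law $\mu$ on $\mathbb{R}$ and constants $0<\theta<1$ and $\frac1{e_0}<\beta<\frac{v_0}{e_0}$, and put $\theta_{th}:=\frac{v_0-e_0\beta}{v_0-1}$; then $0<\theta_{th}<1$. For $n\ge1$ let $G$ be the binomial random graph on $n$ vertices with edge probability $p=n^{-\beta}$, and let $w(h)$, for $h$ in the edge set of the complete graph $K_n$, be i.i.d. random weights with law $\mu$, independent of $G$. A colouring is a map $c$ from the $n$ vertices to $\{1,2,\dots,r\}$ with $r=\lfloor n^{\theta}\rfloor$. For $M>0$ the colouring $c$ is called ($M$-)good if $G$ has a subgraph $T$ isomorphic to $\Gamma$ such that $w(u,v)\le |c(u)-c(v)|\le M$ for every edge $(u,v)$ of $T$. Let $N_{tot}=r^n$ be the number of all colourings and $N_{good}=N_{good}(M)$ the number of good ones. Then there is a constant $M_0>0$, not depending on $n$, such that for every $M>M_0$: (a) If $\theta<\theta_{th}$,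 then there are constants $C_1,C_2>0$, not depending on $n$, such that for all sufficiently large $n$ $$\mathbb{P}\left(N_{good}\ge N_{tot}\left(1-\frac1{n^{C_1}}\right)\right)\ge 1-\frac1{n^{C_2}}.$$ (b) If $\Gamma$ is connected and $\theta>\theta_{th}$, then there are constants $D_1,D_2>0$, not depending on $n$, such that for all sufficiently large $n$ $$\mathbb{P}\left(N_{good}\le \frac{N_{tot}}{n^{D_1}}\right)\ge 1-\frac1{n^{D_2}}.$$ -/

import Mathlib

open MeasureTheory

namespace LocallyCorrect

/-- A finite graph `Γ` is balanced if every (nonempty) subgraph `H` of it, induced or not,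
satisfies `e(H) / v(H) ≤ e(Γ) / v(Γ)`. -/
def IsBalanced {V : Type*} (Γ : SimpleGraph V) : Prop :=
  ∀ H : Γ.Subgraph, H.verts.Nonempty →
    (H.edgeSet.ncard : ℝ) / (H.verts.ncard : ℝ) ≤ (Γ.edgeSet.ncard : ℝ) / (Nat.card V : ℝ)

/-- The edges of the complete graph on the vertices `0, …, n - 1`. -/
abbrev KEdge (n : ℕ) : Type := (⊤ : SimpleGraph (Fin n)).edgeSet

/-- An assignment of real weights to the edges of the complete graph on `n` vertices. -/
abbrev EdgeWeights (n : ℕ) : Type := KEdge n → ℝ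

/-- Colourings of `n` vertices with the colours `1, 2, …, r`. -/
abbrev Colouring (n r : ℕ) : Type := Fin n → Finset.Icc 1 r

/-- The absolute difference of the colours of `u` and `v`. -/
def colourDist {n r : ℕ} (c : Colouring n r) (u v : Fin n) : ℝ :=
  |((c u : ℕ) : ℝ) - ((c v : ℕ) : ℝ)|

/-- The subgraph `T` of `G` is `M`-good for the weights `w` and the colouring `c`:
`w(u, v) ≤ |c(u) - c(v)| ≤ M` for every edge `(u, v)` of `T`. -/
def IsGoodSubgraph {n r : ℕ} {G : SimpleGraph (Fin n)} (w : EdgeWeights n) (M : ℝ)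
    (c : Colouring n r) (T : G.Subgraph) : Prop :=
  ∀ (u v : Fin n) (h : T.Adj u v),
    w ⟨s(u, v), by simpa using h.ne⟩ ≤ colourDist c u v ∧ colourDist c u v ≤ M

/-- The colouring `c` is good: `G` has an `M`-good subgraph that is isomorphic to `Γ`. -/
def IsGoodColouring {V : Type*} (Γ : SimpleGraph V) {n r : ℕ} (G : SimpleGraph (Fin n))
    (w : EdgeWeights n) (M : ℝ) (c : Colouring n r) : Prop :=
  ∃ T : G.Subgraph, Nonempty (T.coe ≃g Γ) ∧ IsGoodSubgraph w M c T

/-- The total number of colourings of `n` vertices with `r` colours. -/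
noncomputable def numColourings (n r : ℕ) : ℕ := Nat.card (Colouring n r)

/-- The number of good colourings of the vertices of `G` with `r` colours. -/
noncomputable def numGoodColourings {V : Type*} (Γ : SimpleGraph V) {n : ℕ} (r : ℕ) (M : ℝ)
    (G : SimpleGraph (Fin n)) (w : EdgeWeights n) : ℕ :=
  Nat.card {c : Colouring n r // IsGoodColouring Γ G w M c}

/-- The edge probability `n ^ (-β)`. -/
noncomputable def edgeProb (β : ℝ) (n : ℕ) : unitInterval :=
  Set.projIcc 0 1 zero_le_one ((n : ℝ) ^ (-β))

/-- For `β > 0` the projection to the unit interval changes nothing. -/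
theorem coe_edgeProb {β : ℝ} (hβ : 0 < β) (n : ℕ) :
    (edgeProb β n : ℝ) = (n : ℝ) ^ (-β) := by
  have h0 : (0 : ℝ) ≤ (n : ℝ) ^ (-β) := Real.rpow_nonneg (Nat.cast_nonneg n) _
  have h1 : (n : ℝ) ^ (-β) ≤ 1 := by
    rcases Nat.eq_zero_or_pos n with rfl | hn
    · rw [Nat.cast_zero, Real.zero_rpow (by linarith)]
      exact zero_le_one
    · exact Real.rpow_le_one_of_one_le_of_nonpos (by exact_mod_cast hn) (by linarith)
  simp only [edgeProb, Set.projIcc_of_mem zero_le_one (show (n : ℝ) ^ (-β) ∈ Set.Icc 0 1 from ⟨h0, h1⟩)]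

/-- The number of colours: the colours are the positive integers up to `n ^ θ`. -/
noncomputable def numColours (θ : ℝ) (n : ℕ) : ℕ := ⌊(n : ℝ) ^ θ⌋₊

/-- The joint law of the binomial random graph on `n` vertices with edge probability `n ^ (-β)`
and of independent edge weights with common law `μ` on the edges of the complete graph, which are
independent of the random graph. -/
noncomputable def weightedRandomGraph (n : ℕ) (β : ℝ) (μ : Measure ℝ) :
    Measure (SimpleGraph (Fin n) × EdgeWeights n) :=
  (SimpleGraph.binomialRandom (Fin n) (edgeProb β n)).prod (Measure.pi fun _ : KEdge n => μ)

end LocallyCorrect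

/-! Both parts control the probability that a uniform random colouring, independent of the weighted
graph, is exceptional. If this is at most `K * n ^ (-δ)`, Markov's inequality over the graph
(`one_sub_le_measureReal_card_le`) makes the fraction of exceptional colourings polynomially small
with high probability.

(a) Choose `d` with `μ (Iic d) > 0` and a colour pattern on `V` whose values are pairwise at least
`d` apart. A copy of `Γ` with weights at most `d`, coloured by a translate of the pattern, is good
once `M` exceeds the diameter. The weights cost a constant and the colours a factor of order `r ^
(-(v₀ - 1))`, so the expected number of such copies has order `n ^ ((θth - θ) * (v₀ - 1))`, which
tends to infinity. The second moment method applies: disjoint copies are independent. Copies sharing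
`s > 0` vertices share at most `e₀ * s / v₀` edges, by balancedness, and a common vertex ties the
two translates together; their relative contribution is thus `O(n ^ (-(θth - θ) / 2))`
(`exponent_le`, `pair_term_le`).

(b) This is a first moment bound that ignores the weights. By connectedness, on a good copy the
colour of one vertex leaves boundedly many choices for the rest, so the expected number of good
copies is `O(n ^ (-(θ - θth) * (v₀ - 1)))`. -/

namespace LocallyCorrect

/-! ### First and second moment inequalities -/

section Probability

variable {Ω : Type*} [MeasurableSpace Ω] (P : Measure Ω) [IsProbabilityMeasure P]

/-- Markov's inequality for the number of indices `c` whose event occurs. -/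
theorem measureReal_lt_card_le {C : Type*} [Fintype C] (B : C → Set Ω)
    (hB : ∀ c, MeasurableSet (B c)) {t : ℝ} (ht : 0 < t) :
    MeasurableSet {ω | t < (Nat.card {c // ω ∈ B c} : ℝ)} ∧
    P.real {ω | t < (Nat.card {c // ω ∈ B c} : ℝ)} ≤ (∑ c, P.real (B c)) / t := by
  classical
  have hf : ∀ ω, (Nat.card {c // ω ∈ B c} : ℝ) = ∑ c, (B c).indicator (fun _ => (1 : ℝ)) ω := by
    intro ω
    rw [Nat.card_eq_fintype_card, Fintype.card_subtype]
    simp [Set.indicator_apply]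
  have hm : Measurable fun ω => ∑ c, (B c).indicator (fun _ => (1 : ℝ)) ω :=
    Finset.measurable_sum _ fun c _ => measurable_const.indicator (hB c)
  have hi : ∀ c, Integrable ((B c).indicator (fun _ => (1 : ℝ))) P := fun c =>
    (integrable_const _).indicator (hB c)
  simp only [hf]
  refine ⟨measurableSet_lt measurable_const hm, ?_⟩
  rw [le_div_iff₀ ht, mul_comm]
  have h1 := mul_meas_ge_le_integral_of_nonneg (μ := P)
    (f := fun ω => ∑ c, (B c).indicator (fun _ => (1 : ℝ)) ω)
    (ae_of_all _ fun ω => Finset.sum_nonneg fun c _ => Set.indicator_nonneg (by simp) _)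
    (integrable_finsetSum _ fun c _ => hi c) t
  rw [integral_finsetSum _ fun c _ => hi c] at h1
  have h2 : ∀ c, ∫ ω, (B c).indicator (fun _ => (1 : ℝ)) ω ∂P = P.real (B c) := by
    intro c
    rw [integral_indicator (hB c)]
    simp
  simp only [h2] at h1
  refine le_trans ?_ h1
  exact mul_le_mul_of_nonneg_left 
    (measureReal_mono fun ω (hω : t < _) => show t ≤ _ from hω.le) ht.le

/-- The second moment method for the number of occurring events. -/
theorem sq_mul_measureReal_forall_notMem_le {I : Type*} [Fintype I] (A : I → Set Ω)
    (hA : ∀ i, MeasurableSet (A i)) (m : ℝ) :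
    m ^ 2 * P.real {ω | ∀ i, ω ∉ A i} ≤
      ∑ i, ∑ j, P.real (A i ∩ A j) - 2 * m * ∑ i, P.real (A i) + m ^ 2 := by
  classical
  set g : Set Ω → Ω → ℝ := fun s => s.indicator (fun _ => (1 : ℝ))
  have hint : ∀ s, MeasurableSet s → Integrable (g s) P := fun s hs =>
    (integrable_const _).indicator hs
  have hval : ∀ s, MeasurableSet s → ∫ ω, g s ω ∂P = P.real s := by
    intro s hs
    simp only [g]
    rw [integral_indicator hs]
    simp
  have hmeas : MeasurableSet {ω | ∀ i, ω ∉ A i} := by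
    have : {ω | ∀ i, ω ∉ A i} = ⋂ i, (A i)ᶜ := by ext; simp
    rw [this]
    exact MeasurableSet.iInter fun i => (hA i).compl
  have hcross : Integrable (fun ω => ∑ i, ∑ j, g (A i ∩ A j) ω) P :=
    integrable_finsetSum _ fun i _ => integrable_finsetSum _ fun j _ =>
      hint _ ((hA i).inter (hA j))
  have hlin : Integrable (fun ω => 2 * m * ∑ i, g (A i) ω) P :=
    (integrable_finsetSum _ fun i _ => hint _ (hA i)).const_mul _
  have hrhs : ∫ ω, (∑ i, ∑ j, g (A i ∩ A j) ω - 2 * m * ∑ i, g (A i) ω + m ^ 2) ∂P =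
      ∑ i, ∑ j, P.real (A i ∩ A j) - 2 * m * ∑ i, P.real (A i) + m ^ 2 := by
    have hd : ∫ ω, ∑ i, ∑ j, g (A i ∩ A j) ω ∂P = ∑ i, ∑ j, P.real (A i ∩ A j) := by
      rw [integral_finsetSum _ fun i _ => integrable_finsetSum _ fun j _ =>
        hint _ ((hA i).inter (hA j))]
      refine Finset.sum_congr rfl fun i _ => ?_
      rw [integral_finsetSum _ fun j _ => hint _ ((hA i).inter (hA j))]
      exact Finset.sum_congr rfl fun j _ => hval _ ((hA i).inter (hA j))
    rw [integral_add (f := fun ω => ∑ i, ∑ j, g (A i ∩ A j) ω - 2 * m * ∑ i, g (A i) ω)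
      (hcross.sub hlin) (integrable_const _), integral_sub hcross hlin, integral_const_mul,
      integral_finsetSum _ fun i _ => hint _ (hA i), hd]
    simp only [hval _ (hA _), integral_const, probReal_univ, smul_eq_mul, one_mul]
  -- With `X` the number of events that occur, it remains to integrate the pointwise inequality `m ^
  -- 2 * 1_{X = 0} ≤ (X - m) ^ 2`, which holds for every real `m`.
  rw [← hrhs, ← hval _ hmeas, ← integral_const_mul]
  refine integral_mono ((hint _ hmeas).const_mul _)
    ((hcross.sub hlin).add (integrable_const _)) fun ω => ?_
  have hsq : ∑ i, ∑ j, g (A i ∩ A j) ω = (∑ i, g (A i) ω) ^ 2 := by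
    rw [sq, Finset.sum_mul_sum]
    refine Finset.sum_congr rfl fun i _ => Finset.sum_congr rfl fun j _ => ?_
    by_cases h : ω ∈ A i <;> by_cases h' : ω ∈ A j <;> simp [g, h, h']
  simp only [hsq]
  by_cases h : ∀ i, ω ∉ A i
  · have : ∑ i, g (A i) ω = 0 := Finset.sum_eq_zero fun i _ => by simp [g, h i]
    rw [this]
    have h1 : g {ω | ∀ i, ω ∉ A i} ω ≤ 1 := Set.indicator_le_self' (by simp) _
    nlinarith [sq_nonneg m]
  · have : g {ω | ∀ i, ω ∉ A i} ω = 0 := Set.indicator_of_notMem (s := {ω | ∀ i, ω ∉ A i}) h _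
    rw [this]
    nlinarith [sq_nonneg (∑ i, g (A i) ω - m)]

/-- The second moment method for events `S i ×ˢ Q i`, where `S i` is a random event and `Q i` is a
set of colourings, when the colouring is uniform and independent of `P`. -/
theorem sq_mul_sum_measureReal_le {C I : Type*} [Fintype C] [Nonempty C] [Fintype I] [DecidableEq C]
    (S : I → Set Ω) (hS : ∀ i, MeasurableSet (S i)) (Q : I → Finset C)
    (dep : I → I → Prop) [∀ i j, Decidable (dep i j)] {a b : ℝ}
    (ha : ∀ i, P.real (S i) = a) (hb : ∀ i, ((Q i).card : ℝ) = b)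
    (hind : ∀ i j, ¬ dep i j → P.real (S i ∩ S j) = a ^ 2 ∧
      ((Q i ∩ Q j).card : ℝ) * Fintype.card C = b ^ 2) :
    (Fintype.card I * a * b / Fintype.card C) ^ 2 * ∑ c, P.real {ω | ∀ i, ¬ (ω ∈ S i ∧ c ∈ Q i)} ≤
      ∑ i, ∑ j, if dep i j then P.real (S i ∩ S j) * ((Q i ∩ Q j).card : ℝ) else 0 := by
  have hN : (0 : ℝ) < Fintype.card C := by exact_mod_cast Fintype.card_pos
  set N : ℝ := (Fintype.card C : ℝ)
  -- The mean over both the graph and the colouring. The same `m` serves for every `c`, although it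
  -- need not be the mean for that `c`.
  set m : ℝ := Fintype.card I * a * b / N with hm
  have key : ∀ c, m ^ 2 * P.real {ω | ∀ i, ¬ (ω ∈ S i ∧ c ∈ Q i)} ≤
      ∑ i, ∑ j, P.real (S i ∩ S j) * (if c ∈ Q i ∩ Q j then 1 else 0) -
        2 * m * ∑ i, P.real (S i) * (if c ∈ Q i then 1 else 0) + m ^ 2 := by
    intro c
    have := sq_mul_measureReal_forall_notMem_le P (fun i => if c ∈ Q i then S i else ∅)
      (fun i => by split_ifs; exacts [hS i, MeasurableSet.empty]) m
    have e1 : ∀ i, P.real (if c ∈ Q i then S i else ∅) =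
        P.real (S i) * (if c ∈ Q i then 1 else 0) := by
      intro i
      by_cases h : c ∈ Q i <;> simp [h]
    have e2 : ∀ i j, P.real ((if c ∈ Q i then S i else ∅) ∩ (if c ∈ Q j then S j else ∅)) =
        P.real (S i ∩ S j) * (if c ∈ Q i ∩ Q j then 1 else 0) := by
      intro i j
      by_cases h : c ∈ Q i <;> by_cases h' : c ∈ Q j <;> simp [h, h']
    have e3 : {ω | ∀ i, ω ∉ if c ∈ Q i then S i else ∅} =
        {ω | ∀ i, ¬ (ω ∈ S i ∧ c ∈ Q i)} := by
      ext ω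
      refine forall_congr' fun i => ?_
      by_cases h : c ∈ Q i <;> simp [h]
    simpa only [e1, e2, e3] using this
  rw [Finset.mul_sum]
  refine (Finset.sum_le_sum fun c _ => key c).trans ?_
  rw [Finset.sum_add_distrib, Finset.sum_sub_distrib, ← Finset.mul_sum]
  rw [Finset.sum_comm, Finset.sum_comm (f := fun c i => P.real (S i) * (if c ∈ Q i then 1 else 0))]
  have h1 : ∀ i, ∑ c, P.real (S i) * (if c ∈ Q i then 1 else 0) = a * b := by
    intro i
    rw [← Finset.mul_sum, ha i, ← hb i]
    simp
  have h2 : ∀ i, ∑ c, ∑ j, P.real (S i ∩ S j) * (if c ∈ Q i ∩ Q j then (1 : ℝ) else 0) =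
      ∑ j, P.real (S i ∩ S j) * ((Q i ∩ Q j).card : ℝ) := by
    intro i
    rw [Finset.sum_comm]
    refine Finset.sum_congr rfl fun j _ => ?_
    rw [← Finset.mul_sum]
    simp [Finset.filter_and]
  simp only [h1, h2]
  -- The summand `a ^ 2 * b ^ 2 / N`, granted to all pairs, totals `N * m ^ 2`. This cancels against
  -- `-2 * m * (N * m) + N * m ^ 2`, so only dependent pairs survive.
  have h3 : ∀ i j, P.real (S i ∩ S j) * ((Q i ∩ Q j).card : ℝ) ≤
      (if dep i j then P.real (S i ∩ S j) * ((Q i ∩ Q j).card : ℝ) else 0) + a ^ 2 * b ^ 2 / N := by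
    intro i j
    split_ifs with h
    · have : 0 ≤ a ^ 2 * b ^ 2 / N := by positivity
      linarith
    · obtain ⟨e1, e2⟩ := hind i j h
      rw [e1, ← e2, zero_add, le_div_iff₀ hN]
      exact le_of_eq (by ring)
  refine (add_le_add_left (sub_le_sub_right
    (Finset.sum_le_sum fun i _ => Finset.sum_le_sum fun j _ => h3 i j) _) _).trans ?_
  simp only [Finset.sum_add_distrib, Finset.sum_const, Finset.card_univ, nsmul_eq_mul]
  have : (Fintype.card I : ℝ) * (Fintype.card I * (a ^ 2 * b ^ 2 / N)) = N * m ^ 2 := by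
    rw [hm]; field_simp
  have h4 : (Fintype.card I : ℝ) * (a * b) = N * m := by
    rw [hm]; field_simp
  rw [this, h4]
  change _ - 2 * m * (N * m) + N * m ^ 2 ≤ _
  linarith

end Probability

/-! ### Probability of prescribed edges with prescribed weights -/

section RandomGraph

open ProbabilityTheory

/-- The edges in `A` are present and their weights lie in `D`. -/
def edgeEvent {n : ℕ} (D : Set ℝ) (A : Finset (Sym2 (Fin n))) :
    Set (SimpleGraph (Fin n) × EdgeWeights n) :=
  {G | ↑A ⊆ G.edgeSet} ×ˢ Set.univ.pi fun e : KEdge n => {x | e.1 ∈ A → x ∈ D}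

theorem edgeEvent_inter {n : ℕ} (D : Set ℝ) (A A' : Finset (Sym2 (Fin n))) :
    edgeEvent D A ∩ edgeEvent D A' = edgeEvent D (A ∪ A') := by
  ext ⟨G, w⟩
  simp only [edgeEvent, Set.mem_inter_iff, Set.mem_prod, Set.mem_ofPred_eq, Set.mem_univ_pi,
    Finset.coe_union, Set.union_subset_iff, Finset.mem_union]
  grind

theorem binomialRandom_real_subset_edgeSet {n : ℕ} (p : unitInterval)
    (A : Finset (Sym2 (Fin n))) (hA : ∀ e ∈ A, ¬ e.IsDiag) :
    MeasurableSet {G : SimpleGraph (Fin n) | ↑A ⊆ G.edgeSet} ∧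
    (SimpleGraph.binomialRandom (Fin n) p).real {G | ↑A ⊆ G.edgeSet} = (p : ℝ) ^ A.card := by
  classical
  have hms : MeasurableSet {s : Set (Sym2 (Fin n)) | (A : Set (Sym2 (Fin n))) ⊆ s} :=
    Set.Finite.measurableSet (Set.toFinite _)
  have hm : MeasurableSet {G : SimpleGraph (Fin n) | ↑A ⊆ G.edgeSet} :=
    SimpleGraph.measurable_edgeSet hms
  refine ⟨hm, ?_⟩
  rw [measureReal_def, SimpleGraph.binomialRandom_eq_map, Measure.map_apply
    SimpleGraph.measurable_fromEdgeSet hm]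
  have : SimpleGraph.fromEdgeSet ⁻¹' {G : SimpleGraph (Fin n) | ↑A ⊆ G.edgeSet} =
      {s : Set (Sym2 (Fin n)) | (A : Set (Sym2 (Fin n))) ⊆ s} := by
    ext s
    simp only [Set.mem_preimage, Set.mem_ofPred_eq, SimpleGraph.edgeSet_fromEdgeSet]
    constructor
    · exact fun h e he => (h he).1
    · exact fun h e he => ⟨h he, hA e he⟩
  rw [this, setBernoulli_eq_map, Measure.map_apply (by fun_prop) hms, Measure.infinitePi_eq_pi]
  have : (fun p : Sym2 (Fin n) → Prop => {i | p i}) ⁻¹' {s | (A : Set (Sym2 (Fin n))) ⊆ s} =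
      Set.univ.pi fun e => {x : Prop | e ∈ A → x} := by
    ext f
    simp [Set.subset_def]
  rw [this, Measure.pi_pi]
  -- The product runs over all of `Sym2`, loops included. A diagonal coordinate is always `False`,
  -- so the value `p` on `A` relies on `hA`.
  have hval : ∀ e : Sym2 (Fin n),
      (unitInterval.toNNReal p • Measure.dirac (e ∈ (Sym2.diagSet : Set (Sym2 (Fin n)))ᶜ) +
        unitInterval.toNNReal (unitInterval.symm p) • Measure.dirac False : Measure Prop)
        {x : Prop | e ∈ A → x} = if e ∈ A then (unitInterval.toNNReal p : ENNReal) else 1 := by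
    intro e
    split_ifs with he
    · have hd := hA e he
      simp [he, hd]
    · simp [he]
  rw [Finset.prod_congr rfl fun e _ => hval e]
  simp [Finset.prod_ite_mem]

/-- By independence each edge costs `n ^ (-β) * μ(D)`. Part (a) uses a half-line for `D`, part (b)
the whole line. -/
theorem weightedRandomGraph_real_edgeEvent {n : ℕ} {β : ℝ} (hβ : 0 < β) (μ : Measure ℝ)
    [IsProbabilityMeasure μ] {D : Set ℝ} (hD : MeasurableSet D)
    (A : Finset (Sym2 (Fin n))) (hA : ∀ e ∈ A, ¬ e.IsDiag) :
    MeasurableSet (edgeEvent D A) ∧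
    (weightedRandomGraph n β μ).real (edgeEvent D A) =
      ((n : ℝ) ^ (-β) * μ.real D) ^ A.card := by
  classical
  obtain ⟨h1, h2⟩ := binomialRandom_real_subset_edgeSet (edgeProb β n) A hA
  have hDs : ∀ e : KEdge n, MeasurableSet {x : ℝ | e.1 ∈ A → x ∈ D} := by
    intro e
    by_cases he : e.1 ∈ A <;> simp [he, hD]
  refine ⟨h1.prod (MeasurableSet.univ_pi hDs), ?_⟩
  rw [weightedRandomGraph, edgeEvent, measureReal_prod_prod, h2, coe_edgeProb hβ, mul_pow,
    measureReal_def (Measure.pi _), Measure.pi_pi, ENNReal.toReal_prod]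
  congr 1
  have hval : ∀ e : KEdge n, (μ {x : ℝ | e.1 ∈ A → x ∈ D}).toReal =
      if e.1 ∈ A then μ.real D else 1 := by
    intro e
    by_cases he : e.1 ∈ A <;> simp [he, measureReal_def]
  rw [Finset.prod_congr rfl fun e _ => hval e, Finset.prod_ite, Finset.prod_const,
    Finset.prod_const_one, mul_one]
  congr 1
  refine Finset.card_bij (fun e _ => e.1) (by simp) (fun _ _ _ _ h => Subtype.ext h) ?_
  intro e he
  exact ⟨⟨e, by simpa using hA e he⟩, by simpa using he, rfl⟩

end RandomGraph

/-! ### Counting colourings and overlapping embeddings -/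

section Counting

/-- The number of colourings whose restriction along an injection is prescribed by `Q`. -/
theorem card_filter_comp_mem {ι W κ : Type*} [Fintype ι] [Fintype W] [Fintype κ]
    [DecidableEq ι] [DecidableEq W] [DecidableEq κ] (φ : W ↪ ι) (Q : Finset (W → κ)) :
    (Finset.univ.filter fun c : ι → κ => c ∘ φ ∈ Q).card =
      Q.card * Fintype.card κ ^ (Fintype.card ι - Fintype.card W) := by
  classical
  let R := {i : ι // i ∉ Set.range φ}
  have hR : Fintype.card R = Fintype.card ι - Fintype.card W := by
    simp only [R]
    rw [Fintype.card_subtype_compl, ← Fintype.card_range φ]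
  have e : (Finset.univ.filter fun c : ι → κ => c ∘ φ ∈ Q).card =
      (Q ×ˢ (Finset.univ : Finset (R → κ))).card := by
    refine Finset.card_bij (fun c _ => (c ∘ φ, fun i => c i.1)) ?_ ?_ ?_
    · intro c hc
      simpa using hc
    · intro c _ c' _ h
      simp only [Prod.mk.injEq] at h
      funext i
      by_cases hi : i ∈ Set.range φ
      · obtain ⟨w, rfl⟩ := hi
        exact congrFun h.1 w
      · exact congrFun h.2 ⟨i, hi⟩
    · rintro ⟨q, s⟩ hq
      have hc : (fun i => if h : i ∈ Set.range φ then q h.choose else s ⟨i, h⟩) ∘ φ = q := by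
        funext w
        have hw : φ w ∈ Set.range φ := ⟨w, rfl⟩
        simp only [Function.comp_apply, dif_pos hw]
        exact congrArg q (φ.injective hw.choose_spec)
      refine ⟨fun i => if h : i ∈ Set.range φ then q h.choose else s ⟨i, h⟩, ?_, ?_⟩
      · simp only [Finset.mem_filter, Finset.mem_univ, true_and, hc]
        exact (Finset.mem_product.1 hq).1
      · refine Prod.ext hc ?_
        funext i
        exact dif_neg i.2
  rw [e, Finset.card_product, Finset.card_univ, Fintype.card_fun, hR]

/-- If the colours on `U` are determined by `g`, then `g` and the colours off `U` count. -/
theorem card_le_of_determined {ι κ F : Type*} [Fintype ι] [Fintype κ] [DecidableEq ι]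
    (T : Finset (ι → κ)) (U : Finset ι) (g : (ι → κ) → F) (Fs : Finset F)
    (hg : ∀ c ∈ T, g c ∈ Fs)
    (hT : ∀ c ∈ T, ∀ c' ∈ T, g c = g c' → ∀ i ∈ U, c i = c' i) :
    T.card ≤ Fs.card * Fintype.card κ ^ (Fintype.card ι - U.card) := by
  classical
  let R := {i : ι // i ∉ U}
  have hR : Fintype.card R = Fintype.card ι - U.card := by
    simp only [R]
    rw [Fintype.card_subtype_compl]
    simp
  have := Finset.card_le_card_of_injOn (s := T) (t := Fs ×ˢ (Finset.univ : Finset (R → κ)))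
    (fun c => (g c, fun i => c i.1)) (fun c hc => by simpa using hg c hc) (by
      intro c hc c' hc' h
      simp only [Prod.mk.injEq] at h
      funext i
      by_cases hi : i ∈ U
      · exact hT c hc c' hc' h.1 i hi
      · exact congrFun h.2 ⟨i, hi⟩)
  rwa [Finset.card_product, Finset.card_univ, Fintype.card_fun, hR] at this

variable {V : Type*} [Fintype V]

/-- The number of points of `V` mapped into the range of `φ` by `ψ`. -/
def overlap {n : ℕ} (φ : V ↪ Fin n) (ψ : V → Fin n) : ℕ :=
  (Finset.univ.filter fun v => ψ v ∈ Finset.univ.map φ).card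

theorem card_map_union_map {n : ℕ} (φ ψ : V ↪ Fin n) :
    (Finset.univ.map φ ∪ Finset.univ.map ψ).card + overlap φ ψ = 2 * Fintype.card V := by
  have h : overlap φ ψ = (Finset.univ.map φ ∩ Finset.univ.map ψ).card := by
    rw [overlap, ← Finset.card_map ψ]
    congr 1
    ext x
    simp only [Finset.mem_map, Finset.mem_filter, Finset.mem_inter, Finset.mem_univ, true_and]
    constructor
    · rintro ⟨v, ⟨u, hu⟩, rfl⟩
      exact ⟨⟨u, hu⟩, v, rfl⟩
    · rintro ⟨⟨u, hu⟩, v, rfl⟩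
      exact ⟨v, ⟨u, hu⟩, rfl⟩
  rw [h, Finset.card_union_add_card_inter]
  simp [two_mul]

/-- Dropping injectivity of `ψ` makes the sum factor over the vertices. Each factor has `v₀` terms
`n` and at most `n` terms `1`. Thus weighting by `n ^ overlap` costs only a constant over the
trivial count `n ^ v₀`. -/
theorem sum_pow_overlap_le [DecidableEq V] {n : ℕ} (φ : V ↪ Fin n) :
    ∑ ψ : V ↪ Fin n, (n : ℝ) ^ overlap φ ψ ≤
      ((Fintype.card V + 1 : ℝ) * n) ^ Fintype.card V := by
  have h1 : ∑ ψ : V ↪ Fin n, (n : ℝ) ^ overlap φ ψ ≤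
      ∑ ψ : V → Fin n, (n : ℝ) ^ overlap φ ψ := by
    have := Finset.sum_map (Finset.univ : Finset (V ↪ Fin n))
      ⟨fun ψ => (ψ : V → Fin n), DFunLike.coe_injective⟩ fun ψ => (n : ℝ) ^ overlap φ ψ
    simp only [Function.Embedding.coeFn_mk] at this
    rw [← this]
    exact Finset.sum_le_sum_of_subset_of_nonneg (Finset.subset_univ _) fun _ _ _ => by positivity
  refine h1.trans ?_
  have h2 : ∀ ψ : V → Fin n, (n : ℝ) ^ overlap φ ψ =
      ∏ v, if ψ v ∈ Finset.univ.map φ then (n : ℝ) else 1 := by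
    intro ψ
    rw [Finset.prod_ite, Finset.prod_const, Finset.prod_const_one, mul_one]
    rfl
  simp only [h2]
  have h3 := Finset.prod_univ_sum (fun _ : V => (Finset.univ : Finset (Fin n)))
    fun _ x => if x ∈ Finset.univ.map φ then (n : ℝ) else 1
  rw [Fintype.piFinset_univ] at h3
  rw [← h3, Finset.prod_const, Finset.card_univ]
  gcongr
  calc ∑ x : Fin n, (if x ∈ Finset.univ.map φ then (n : ℝ) else 1)
      ≤ ∑ x : Fin n, ((if x ∈ Finset.univ.map φ then (n : ℝ) else 0) + 1) := by
        refine Finset.sum_le_sum fun x _ => ?_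
        split_ifs <;> simp
    _ = _ := by
        rw [Finset.sum_add_distrib, Finset.sum_ite_mem, Finset.univ_inter, Finset.sum_const,
          Finset.card_map]
        simp
        ring

end Counting

/-! ### Edge sets of copies and balancedness -/

section Edges

variable {V : Type*} [Fintype V] (Γ : SimpleGraph V)

/-- The images of the edges of `Γ` under `φ`. -/
noncomputable def edgeImage {n : ℕ} (φ : V ↪ Fin n) : Finset (Sym2 (Fin n)) :=
  (Set.toFinite Γ.edgeSet).toFinset.map φ.sym2Map

theorem card_edgeImage {n : ℕ} (φ : V ↪ Fin n) :
    (edgeImage Γ φ).card = Γ.edgeSet.ncard := by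
  rw [edgeImage, Finset.card_map, Set.ncard_eq_toFinset_card]

theorem mk_mem_edgeImage {n : ℕ} (φ : V ↪ Fin n) {u v : V} (h : Γ.Adj u v) :
    s(φ u, φ v) ∈ edgeImage Γ φ := by
  rw [edgeImage, Finset.mem_map]
  exact ⟨s(u, v), by simpa using h, rfl⟩

theorem exists_of_mem_edgeImage {n : ℕ} {φ : V ↪ Fin n} {e : Sym2 (Fin n)}
    (h : e ∈ edgeImage Γ φ) : ∃ u v, Γ.Adj u v ∧ e = s(φ u, φ v) := by
  rw [edgeImage, Finset.mem_map] at h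
  obtain ⟨e', he', rfl⟩ := h
  induction e' with | _ u v => exact ⟨u, v, by simpa using he', rfl⟩

theorem not_isDiag_of_mem_edgeImage {n : ℕ} {φ : V ↪ Fin n} {e : Sym2 (Fin n)}
    (h : e ∈ edgeImage Γ φ) : ¬ e.IsDiag := by
  obtain ⟨u, v, huv, rfl⟩ := exists_of_mem_edgeImage Γ h
  simpa using huv.ne

theorem edgeImage_subset_iff {n : ℕ} (φ : V ↪ Fin n) (G : SimpleGraph (Fin n)) :
    ↑(edgeImage Γ φ) ⊆ G.edgeSet ↔ ∀ u v, Γ.Adj u v → G.Adj (φ u) (φ v) := by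
  constructor
  · intro h u v huv
    exact h (mk_mem_edgeImage Γ φ huv)
  · intro h e he
    obtain ⟨u, v, huv, rfl⟩ := exists_of_mem_edgeImage Γ he
    exact h u v huv

/-- Both ends of a shared edge are shared vertices. Pulled back along `ψ`, shared edges therefore
lie in the subgraph of `Γ` induced on the overlap, whose density balancedness bounds. -/
theorem card_edgeImage_inter_le {n : ℕ} (hΓ : IsBalanced Γ) (φ ψ : V ↪ Fin n)
    (h : 0 < overlap φ ψ) :
    ((edgeImage Γ φ ∩ edgeImage Γ ψ).card : ℝ) ≤
      Γ.edgeSet.ncard * overlap φ ψ / Nat.card V := by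
  classical
  set s : Finset V := Finset.univ.filter fun v => ψ v ∈ Finset.univ.map φ with hs
  let H : Γ.Subgraph := (⊤ : Γ.Subgraph).induce s
  have hv : H.verts = s := rfl
  have hH := hΓ H (by rw [hv]; exact Finset.coe_nonempty.2 (Finset.card_pos.1 h))
  have hn : H.verts.ncard = overlap φ ψ := by rw [hv, Set.ncard_coe_finset]; rfl
  rw [hn, div_le_iff₀ (by exact_mod_cast h)] at hH
  have hle : (edgeImage Γ φ ∩ edgeImage Γ ψ).card ≤ H.edgeSet.ncard := by
    rw [← Set.ncard_map (f := ψ.sym2Map), ← Set.ncard_coe_finset]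
    refine Set.ncard_le_ncard ?_ (Set.toFinite _)
    intro e he
    simp only [Finset.coe_inter, Set.mem_inter_iff, Finset.mem_coe] at he
    obtain ⟨u, v, huv, rfl⟩ := exists_of_mem_edgeImage Γ he.2
    obtain ⟨u', v', _, he'⟩ := exists_of_mem_edgeImage Γ he.1
    refine ⟨s(u, v), ?_, rfl⟩
    have : ψ u ∈ Finset.univ.map φ ∧ ψ v ∈ Finset.univ.map φ := by
      rw [Sym2.eq_iff] at he'
      rcases he' with ⟨h1, h2⟩ | ⟨h1, h2⟩ <;> simp [h1, h2]
    simp [H, hs, huv]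
    simpa using this
  calc ((edgeImage Γ φ ∩ edgeImage Γ ψ).card : ℝ) ≤ H.edgeSet.ncard := by exact_mod_cast hle
    _ ≤ _ := hH
    _ = _ := by ring

end Edges

/-! ### From averages to high probability -/

/-- If on average a fraction `K * n ^ (-δ)` of the events occurs, then with high probability only
a polynomially small fraction does. -/
theorem one_sub_le_measureReal_card_le {Ω : Type*} [MeasurableSpace Ω] (P : Measure Ω)
    [IsProbabilityMeasure P] {C : Type*} [Fintype C] [Nonempty C] (B : C → Set Ω)
    (hB : ∀ c, MeasurableSet (B c)) {K δ : ℝ} {n : ℕ} (hn : 0 < n)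
    (hK : K ≤ (n : ℝ) ^ (δ / 2))
    (h : ∑ c, P.real (B c) ≤ K * (n : ℝ) ^ (-δ) * Fintype.card C) :
    1 - 1 / (n : ℝ) ^ (δ / 4) ≤
      P.real {ω | (Nat.card {c // ω ∈ B c} : ℝ) ≤ Fintype.card C / (n : ℝ) ^ (δ / 4)} := by
  have hn' : (0 : ℝ) < n := by exact_mod_cast hn
  have hC : (0 : ℝ) < Fintype.card C := by exact_mod_cast Fintype.card_pos
  have hx : (0 : ℝ) < (n : ℝ) ^ (δ / 4) := Real.rpow_pos_of_pos hn' _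
  obtain ⟨hm, hle⟩ := measureReal_lt_card_le P B hB (div_pos hC hx)
  have hc : {ω | (Nat.card {c // ω ∈ B c} : ℝ) ≤ Fintype.card C / (n : ℝ) ^ (δ / 4)} =
      {ω | (Fintype.card C / (n : ℝ) ^ (δ / 4) : ℝ) < Nat.card {c // ω ∈ B c}}ᶜ := by
    ext; simp
  rw [hc, probReal_compl_eq_one_sub hm]
  -- Of the exponent `δ`, one half absorbs `K`, a quarter goes into the Markov threshold, and a
  -- quarter remains as the error probability.
  have : (∑ c, P.real (B c)) / (Fintype.card C / (n : ℝ) ^ (δ / 4)) ≤ 1 / (n : ℝ) ^ (δ / 4) := by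
    rw [div_le_iff₀ (div_pos hC hx)]
    refine h.trans ?_
    have e1 : K * (n : ℝ) ^ (-δ) ≤ (n : ℝ) ^ (δ / 2) * (n : ℝ) ^ (-δ) := by gcongr
    have e2 : (n : ℝ) ^ (δ / 2) * (n : ℝ) ^ (-δ) * ((n : ℝ) ^ (δ / 4) * (n : ℝ) ^ (δ / 4)) = 1 := by
      rw [← Real.rpow_add hn', ← Real.rpow_add hn', ← Real.rpow_add hn']
      ring_nf
      exact Real.rpow_zero _
    have e3 : 1 / (n : ℝ) ^ (δ / 4) * (Fintype.card C / (n : ℝ) ^ (δ / 4)) =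
        (n : ℝ) ^ (δ / 2) * (n : ℝ) ^ (-δ) * Fintype.card C := by
      rw [div_mul_div_comm, div_eq_iff (by positivity), one_mul]
      linear_combination (-(Fintype.card C : ℝ)) * e2
    rw [e3]
    gcongr
  linarith

/-! ### Colourings that follow a translated pattern -/

section Patterns

variable {V : Type*} [Fintype V] {r : ℕ}

open Classical in
/-- The translates of the pattern `pat` that fit into `{1, …, r}`. -/
noncomputable def patternSet (pat : V → ℕ) (r : ℕ) : Finset (V → Finset.Icc 1 r) :=
  Finset.univ.filter fun f => ∃ a : ℕ, ∀ v, (f v : ℕ) = a + pat v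

theorem mem_patternSet {pat : V → ℕ} {f : V → Finset.Icc 1 r} :
    f ∈ patternSet pat r ↔ ∃ a : ℕ, ∀ v, (f v : ℕ) = a + pat v := by
  simp [patternSet]

/-- The shifts `1, …, r - L` all fit, and distinct shifts give distinct colourings since `V` is
nonempty. -/
theorem sub_le_card_patternSet [Nonempty V] {pat : V → ℕ} {L : ℕ} (hL : ∀ v, pat v ≤ L) :
    r - L ≤ (patternSet pat r).card := by
  classical
  have h : ((Finset.Icc 1 (r - L)).attach).card ≤ (patternSet pat r).card := by
    refine Finset.card_le_card_of_injOn
      (fun a v => ⟨a.1 + pat v, by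
        have h1 := Finset.mem_Icc.1 a.2
        have h2 := hL v
        exact Finset.mem_Icc.2 ⟨by omega, by omega⟩⟩) ?_ ?_
    · intro a _
      exact mem_patternSet.2 ⟨a.1, fun v => rfl⟩
    · intro a _ a' _ haa
      obtain ⟨v⟩ := ‹Nonempty V›
      have := congrArg Subtype.val (congrFun haa v)
      exact Subtype.ext (by simpa using this)
  simpa using h

open Classical in
/-- The colourings that follow a translate of `pat` along `φ`. -/
noncomputable def patternColourings {n : ℕ} (pat : V → ℕ) (r : ℕ) (φ : V ↪ Fin n) :
    Finset (Colouring n r) :=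
  Finset.univ.filter fun c => c ∘ φ ∈ patternSet pat r

theorem card_patternColourings {n : ℕ} (pat : V → ℕ) (φ : V ↪ Fin n) :
    (patternColourings pat r φ).card =
      (patternSet pat r).card * r ^ (n - Fintype.card V) := by
  classical
  have := card_filter_comp_mem (κ := Finset.Icc 1 r) φ (patternSet pat r)
  simp only [Fintype.card_coe, Nat.card_Icc, Nat.add_sub_cancel, Fintype.card_fin] at this
  rw [← this, patternColourings]

-- Independence of the colour events of disjoint copies, without division: the two embeddings glue
-- to one embedding of `V ⊕ V`, whose pattern set is a product.
open Classical in
theorem card_patternColourings_inter_of_overlap_eq_zero {n : ℕ} (pat : V → ℕ) (φ ψ : V ↪ Fin n)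
    (h : overlap φ ψ = 0) :
    (patternColourings pat r φ ∩ patternColourings pat r ψ).card * r ^ n =
      ((patternSet pat r).card * r ^ (n - Fintype.card V)) ^ 2 := by
  have hd : ∀ u v, φ u ≠ ψ v := by
    intro u v huv
    rw [overlap, Finset.card_eq_zero] at h
    have : v ∈ (∅ : Finset V) := by
      rw [← h]
      simp only [Finset.mem_filter, Finset.mem_univ, true_and]
      exact Finset.mem_map.2 ⟨u, Finset.mem_univ _, huv⟩
    simp at this
  let χ : V ⊕ V ↪ Fin n := ⟨Sum.elim φ ψ, φ.injective.sumElim ψ.injective hd⟩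
  let Q : Finset (V ⊕ V → Finset.Icc 1 r) := (patternSet pat r ×ˢ patternSet pat r).map
    (Equiv.sumArrowEquivProdArrow V V (Finset.Icc 1 r)).symm.toEmbedding
  have hQ : Q.card = (patternSet pat r).card ^ 2 := by
    rw [Finset.card_map, Finset.card_product, sq]
  have e : patternColourings pat r φ ∩ patternColourings pat r ψ =
      Finset.univ.filter fun c => c ∘ χ ∈ Q := by
    ext c
    simp only [patternColourings, Finset.mem_inter, Finset.mem_filter, Finset.mem_univ, true_and,
      Q, Finset.mem_map_equiv, Finset.mem_product, Equiv.symm_symm]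
    rfl
  have hn : 2 * Fintype.card V ≤ n := by
    have := Fintype.card_le_of_embedding χ
    simp only [Fintype.card_sum, Fintype.card_fin] at this
    omega
  have := card_filter_comp_mem (κ := Finset.Icc 1 r) χ Q
  simp only [Fintype.card_coe, Nat.card_Icc, Nat.add_sub_cancel, Fintype.card_fin,
    Fintype.card_sum] at this
  rw [e]
  have e2 : (Finset.univ.filter fun c : Colouring n r => c ∘ χ ∈ Q).card =
    Q.card * r ^ (n - (Fintype.card V + Fintype.card V)) := by
    rw [← this]
  rw [e2, hQ, mul_pow, mul_assoc, ← pow_add, ← pow_mul]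
  congr 2
  omega

-- The colour of one common vertex fixes the shifts of both copies, hence all colours on their
-- union. This leaves `r` choices there and free colours elsewhere.
open Classical in
theorem card_patternColourings_inter_le {n : ℕ} (pat : V → ℕ) (φ ψ : V ↪ Fin n)
    (h : 0 < overlap φ ψ) :
    (patternColourings pat r φ ∩ patternColourings pat r ψ).card ≤
      r * r ^ (n - (2 * Fintype.card V - overlap φ ψ)) := by
  have hU : (Finset.univ.map φ ∪ Finset.univ.map ψ).card =
      2 * Fintype.card V - overlap φ ψ := by
    have := card_map_union_map φ ψ
    omega
  obtain ⟨v₁, hv₁⟩ := Finset.card_pos.1 h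
  simp only [Finset.mem_filter, Finset.mem_univ, true_and, Finset.mem_map] at hv₁
  obtain ⟨u₁, hu₁⟩ := hv₁
  have := card_le_of_determined (patternColourings pat r φ ∩ patternColourings pat r ψ)
    (Finset.univ.map φ ∪ Finset.univ.map ψ) (fun c => c (ψ v₁)) Finset.univ
    (fun _ _ => Finset.mem_univ _) (by
      intro c hc c' hc' hcc i hi
      simp only [patternColourings, Finset.mem_inter, Finset.mem_filter, Finset.mem_univ,
        true_and, mem_patternSet, Function.comp_apply] at hc hc'
      obtain ⟨⟨a, ha⟩, b, hb⟩ := hc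
      obtain ⟨⟨a', ha'⟩, b', hb'⟩ := hc'
      have hv := congrArg Subtype.val hcc
      have h1 := hb v₁
      have h2 := hb' v₁
      have h3 := ha u₁
      have h4 := ha' u₁
      rw [hu₁] at h3 h4
      apply Subtype.ext
      rcases Finset.mem_union.1 hi with hi | hi
      · obtain ⟨u, -, rfl⟩ := Finset.mem_map.1 hi
        rw [ha u, ha' u]
        omega
      · obtain ⟨u, -, rfl⟩ := Finset.mem_map.1 hi
        rw [hb u, hb' u]
        omega)
  rw [hU] at this
  simpa using this

end Patterns

/-! ### Second moment estimate below the threshold -/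

/-- With `x = (v₀ - 1) * s / v₀`, the definition of `θth` gives `β * e₀ * s / v₀ = s - θth * x`.
Since `s - 1 ≤ x`, the left side is at most `s - (θth - θ) * x`, and `x ≥ 1 / 2`. -/
theorem exponent_le {v₀ e₀ β θ θth s k : ℝ} (hv₀ : 2 ≤ v₀) (hβ : 0 < β)
    (hθ : 0 < θ) (hθth : θth * (v₀ - 1) = v₀ - e₀ * β) (h : θ < θth)
    (hs1 : 1 ≤ s) (hs : s ≤ v₀) (hk : k ≤ e₀ * s / v₀) :
    β * k + θ * (s - 1) ≤ s - (θth - θ) / 2 := by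
  have hv : 0 < v₀ := by linarith
  set x := (v₀ - 1) * s / v₀ with hx
  have h1 : s - 1 ≤ x := by
    rw [hx, le_div_iff₀ hv]; nlinarith
  have h2 : 1 / 2 ≤ x := by
    rw [hx, le_div_iff₀ hv]; nlinarith
  have h3 : β * k ≤ s - θth * x := by
    calc β * k ≤ β * (e₀ * s / v₀) := by gcongr
      _ = s - θth * x := by
        rw [hx]
        field_simp
        linear_combination hθth
  nlinarith [mul_le_mul_of_nonneg_left h1 hθ.le, mul_le_mul_of_nonneg_left h2 (sub_pos.2 h).le]

theorem half_pow_le_card_embedding {V : Type*} [Fintype V] [DecidableEq V] {n : ℕ}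
    (hn : 2 * Fintype.card V ≤ n) :
    ((n : ℝ) / 2) ^ Fintype.card V ≤ Fintype.card (V ↪ Fin n) := by
  rw [Fintype.card_embedding_eq, Fintype.card_fin]
  have h1 := Nat.pow_sub_le_descFactorial n (Fintype.card V)
  have h2 : ((n + 1 - Fintype.card V : ℕ) : ℝ) ^ Fintype.card V ≤
      (n.descFactorial (Fintype.card V) : ℝ) := by exact_mod_cast h1
  refine le_trans ?_ h2
  gcongr
  rw [Nat.cast_sub (by omega)]
  have : (2 * Fintype.card V : ℝ) ≤ n := by exact_mod_cast hn
  push_cast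
  linarith

theorem card_embedding_le {V : Type*} [Fintype V] [DecidableEq V] {n : ℕ} :
    (Fintype.card (V ↪ Fin n) : ℝ) ≤ (n : ℝ) ^ Fintype.card V := by
  rw [Fintype.card_embedding_eq, Fintype.card_fin]
  exact_mod_cast Nat.descFactorial_le_pow n _

variable {V : Type*} [Fintype V] (Γ : SimpleGraph V)

/-- The contribution of two overlapping copies to the second moment. -/
theorem pair_term_le {v₀ e₀ n r s k : ℕ} {β θ θth q : ℝ} (hv₀ : 2 ≤ v₀) (hn : 0 < n)
    (hr : 0 < r) (hrn : (r : ℝ) ≤ (n : ℝ) ^ θ) (hq : 0 < q) (hq1 : q ≤ 1) (hβ : 0 < β)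
    (hθ : 0 < θ) (hθth : θth * ((v₀ : ℝ) - 1) = v₀ - e₀ * β) (h : θ < θth)
    (hs1 : 1 ≤ s) (hs : s ≤ v₀) (hsn : 2 * v₀ - s ≤ n)
    (hk : (k : ℝ) ≤ e₀ * s / v₀) (hke : k ≤ e₀) :
    ((n : ℝ) ^ (-β) * q) ^ (2 * e₀ - k) * ((r : ℝ) * (r : ℝ) ^ (n - (2 * v₀ - s))) ≤
      ((n : ℝ) ^ (-β) * q) ^ (2 * e₀) * (r : ℝ) ^ n / ((r : ℝ) ^ (2 * (v₀ - 1)) * q ^ e₀) *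
        (n : ℝ) ^ (-((θth - θ) / 2)) * (n : ℝ) ^ s := by
  have hn' : (0 : ℝ) < n := by exact_mod_cast hn
  have hn1 : (1 : ℝ) ≤ n := by exact_mod_cast hn
  have hr' : (0 : ℝ) < r := by exact_mod_cast hr
  set ν : ℝ := (n : ℝ) ^ (-β) with hν
  have hν0 : 0 < ν := Real.rpow_pos_of_pos hn' _
  have h1 : (ν * q) ^ (2 * e₀ - k) * (ν * q) ^ k = (ν * q) ^ (2 * e₀) := by
    rw [← pow_add]; congr 1; omega
  have h2 : ((r : ℝ) * (r : ℝ) ^ (n - (2 * v₀ - s))) * (r : ℝ) ^ (2 * (v₀ - 1)) =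
      (r : ℝ) ^ n * (r : ℝ) ^ (s - 1) := by
    rw [← pow_succ', ← pow_add, ← pow_add]; congr 1; omega
  have h3 : (r : ℝ) ^ (s - 1) * q ^ e₀ ≤
      (ν * q) ^ k * ((n : ℝ) ^ (-((θth - θ) / 2)) * (n : ℝ) ^ s) := by
    have hexp := exponent_le (v₀ := v₀) (e₀ := e₀) (s := s) (k := k) (by exact_mod_cast hv₀) hβ hθ
      hθth h (by exact_mod_cast hs1) (by exact_mod_cast hs) hk
    have e1 : (r : ℝ) ^ (s - 1) ≤ (n : ℝ) ^ (θ * ((s : ℝ) - 1)) := by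
      rw [Real.rpow_mul hn'.le, ← Nat.cast_pred hs1, Real.rpow_natCast]
      gcongr
    have e2 : q ^ e₀ ≤ q ^ k := pow_le_pow_of_le_one hq.le hq1 hke
    have e3 : ν ^ k = (n : ℝ) ^ (-β * k) := by
      rw [hν, Real.rpow_mul hn'.le, Real.rpow_natCast]
    have e4 : (n : ℝ) ^ (θ * ((s : ℝ) - 1)) ≤
        ν ^ k * ((n : ℝ) ^ (-((θth - θ) / 2)) * (n : ℝ) ^ s) := by
      rw [e3, ← Real.rpow_natCast _ s, ← Real.rpow_add hn', ← Real.rpow_add hn']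
      exact Real.rpow_le_rpow_of_exponent_le hn1 (by linarith)
    calc (r : ℝ) ^ (s - 1) * q ^ e₀
        ≤ (ν ^ k * ((n : ℝ) ^ (-((θth - θ) / 2)) * (n : ℝ) ^ s)) * q ^ k := by
          gcongr
          exact e1.trans e4
      _ = _ := by rw [mul_pow]; ring
  have hz : 0 < (r : ℝ) ^ (2 * (v₀ - 1)) * q ^ e₀ * (ν * q) ^ k := by positivity
  refine le_of_mul_le_mul_right ?_ hz
  calc _ = ((ν * q) ^ (2 * e₀ - k) * (ν * q) ^ k) *
        (((r : ℝ) * (r : ℝ) ^ (n - (2 * v₀ - s))) * (r : ℝ) ^ (2 * (v₀ - 1))) * q ^ e₀ := by ring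
    _ = (ν * q) ^ (2 * e₀) * (r : ℝ) ^ n * ((r : ℝ) ^ (s - 1) * q ^ e₀) := by rw [h1, h2]; ring
    _ ≤ (ν * q) ^ (2 * e₀) * (r : ℝ) ^ n *
        ((ν * q) ^ k * ((n : ℝ) ^ (-((θth - θ) / 2)) * (n : ℝ) ^ s)) := by gcongr
    _ = _ := by field_simp

/-- The weighted graphs for which no copy of `Γ` with weights in `D` follows the pattern. -/
def noPatternEvent (D : Set ℝ) (pat : V → ℕ) {n r : ℕ} (c : Colouring n r) :
    Set (SimpleGraph (Fin n) × EdgeWeights n) :=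
  {x | ∀ φ : V ↪ Fin n, ¬ (x ∈ edgeEvent D (edgeImage Γ φ) ∧ c ∈ patternColourings pat r φ)}

theorem measurableSet_noPatternEvent {D : Set ℝ} (hD : MeasurableSet D) (pat : V → ℕ) {n r : ℕ}
    (c : Colouring n r) : MeasurableSet (noPatternEvent Γ D pat c) := by
  have : noPatternEvent Γ D pat c = ⋂ φ : V ↪ Fin n,
      {x | ¬ (x ∈ edgeEvent D (edgeImage Γ φ) ∧ c ∈ patternColourings pat r φ)} := by
    ext; simp [noPatternEvent]
  rw [this]
  refine MeasurableSet.iInter fun φ => ?_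
  -- Only measurability is extracted, so `β = 1` and the Dirac mass are arbitrary choices.
  have hm := (weightedRandomGraph_real_edgeEvent (β := 1) one_pos (Measure.dirac 0) hD
    (edgeImage Γ φ) fun e he => not_isDiag_of_mem_edgeImage Γ he).1
  by_cases hc : c ∈ patternColourings pat r φ
  · have : {x | ¬ (x ∈ edgeEvent D (edgeImage Γ φ) ∧ c ∈ patternColourings pat r φ)} =
        (edgeEvent D (edgeImage Γ φ))ᶜ := by ext; simp [hc]
    rw [this]
    exact hm.compl
  · simp [hc]

theorem sum_measureReal_noPatternEvent_le (hΓ : IsBalanced Γ) (hv₀ : 2 ≤ Fintype.card V)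
    (μ : Measure ℝ) [IsProbabilityMeasure μ] {D : Set ℝ} (hD : MeasurableSet D)
    (hq : 0 < μ.real D) {β θ θth : ℝ} (hβ : 0 < β) (hθ : 0 < θ)
    (hθth : θth * ((Fintype.card V : ℝ) - 1) = Fintype.card V - Γ.edgeSet.ncard * β)
    (h : θ < θth) {pat : V → ℕ} {L : ℕ} (hL : ∀ v, pat v ≤ L) {n r : ℕ}
    (hn : 2 * Fintype.card V ≤ n) (hr : 0 < r) (hrL : 2 * L ≤ r) (hrn : (r : ℝ) ≤ (n : ℝ) ^ θ) :
    ∑ c : Colouring n r, (weightedRandomGraph n β μ).real (noPatternEvent Γ D pat c) ≤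
      4 * (2 * (Fintype.card V + 1 : ℝ)) ^ Fintype.card V / μ.real D ^ Γ.edgeSet.ncard *
        (n : ℝ) ^ (-((θth - θ) / 2)) * (r : ℝ) ^ n := by
  classical
  have hprob : IsProbabilityMeasure (weightedRandomGraph n β μ) := by
    unfold weightedRandomGraph; infer_instance
  have hne : Nonempty V := Fintype.card_pos_iff.1 (by omega)
  have hCne : Nonempty (Colouring n r) := ⟨fun _ => ⟨1, Finset.mem_Icc.2 ⟨le_rfl, hr⟩⟩⟩
  set v₀ := Fintype.card V with hv₀def
  set e₀ := Γ.edgeSet.ncard with he₀def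
  set q := μ.real D with hqdef
  have hq1 : q ≤ 1 := measureReal_le_one
  have hn0 : 0 < n := by omega
  have hn' : (0 : ℝ) < n := by exact_mod_cast hn0
  have hr' : (0 : ℝ) < r := by exact_mod_cast hr
  set p' : ℝ := (n : ℝ) ^ (-β) * q with hp'
  have hp'0 : 0 < p' := mul_pos (Real.rpow_pos_of_pos hn' _) hq
  have hP : ∀ A : Finset (Sym2 (Fin n)), (∀ e ∈ A, ¬ e.IsDiag) →
      MeasurableSet (edgeEvent D A) ∧
      (weightedRandomGraph n β μ).real (edgeEvent D A) = p' ^ A.card :=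
    fun A hA => weightedRandomGraph_real_edgeEvent hβ μ hD A hA
  have hdiag : ∀ φ : V ↪ Fin n, ∀ e ∈ edgeImage Γ φ, ¬ e.IsDiag := fun φ e he =>
    not_isDiag_of_mem_edgeImage Γ he
  have hP2 : ∀ φ ψ : V ↪ Fin n, (weightedRandomGraph n β μ).real
      (edgeEvent D (edgeImage Γ φ) ∩ edgeEvent D (edgeImage Γ ψ)) =
      p' ^ (2 * e₀ - (edgeImage Γ φ ∩ edgeImage Γ ψ).card) := by
    intro φ ψ
    rw [edgeEvent_inter, (hP _ fun e he => (Finset.mem_union.1 he).elim (hdiag φ e) (hdiag ψ e)).2]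
    congr 1
    have := Finset.card_union_add_card_inter (edgeImage Γ φ) (edgeImage Γ ψ)
    rw [card_edgeImage, card_edgeImage] at this
    omega
  have hcardC : (Fintype.card (Colouring n r) : ℝ) = (r : ℝ) ^ n := by simp
  set t : ℕ := (patternSet pat r).card with ht
  have hsm := sq_mul_sum_measureReal_le (weightedRandomGraph n β μ)
    (fun φ : V ↪ Fin n => edgeEvent D (edgeImage Γ φ)) (fun φ => (hP _ (hdiag φ)).1)
    (fun φ => patternColourings pat r φ) (fun φ ψ => 0 < overlap φ ψ)
    (a := p' ^ e₀) (b := (t : ℝ) * (r : ℝ) ^ (n - v₀))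
    (fun φ => by rw [(hP _ (hdiag φ)).2, card_edgeImage])
    (fun φ => by rw [card_patternColourings]; push_cast; rfl) (by
      intro φ ψ hφψ
      have ho : overlap φ ψ = 0 := by omega
      constructor
      · rw [hP2, ← pow_mul, mul_comm e₀ 2]
        have : edgeImage Γ φ ∩ edgeImage Γ ψ = ∅ := by
          rw [Finset.eq_empty_iff_forall_notMem]
          intro e he
          obtain ⟨he1, he2⟩ := Finset.mem_inter.1 he
          obtain ⟨u, v, -, rfl⟩ := exists_of_mem_edgeImage Γ he2
          obtain ⟨u', v', -, he'⟩ := exists_of_mem_edgeImage Γ he1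
          have hu : u ∈ (∅ : Finset V) := by
            rw [← Finset.card_eq_zero.1 ho]
            simp only [Finset.mem_filter, Finset.mem_univ, true_and]
            rw [Sym2.eq_iff] at he'
            rcases he' with ⟨h1, -⟩ | ⟨h1, -⟩ <;> simp [h1]
          simp at hu
        rw [this, Finset.card_empty, Nat.sub_zero]
      · rw [hcardC]
        exact_mod_cast card_patternColourings_inter_of_overlap_eq_zero pat φ ψ ho)
  rw [hcardC] at hsm
  set E : ℝ := ∑ c : Colouring n r, (weightedRandomGraph n β μ).real (noPatternEvent Γ D pat c)
    with hE
  have hEe : ∑ c : Colouring n r, (weightedRandomGraph n β μ).real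
      {ω | ∀ φ : V ↪ Fin n, ¬ (ω ∈ edgeEvent D (edgeImage Γ φ) ∧ c ∈ patternColourings pat r φ)} =
      E := rfl
  rw [hEe] at hsm
  set ε : ℝ := (n : ℝ) ^ (-((θth - θ) / 2)) with hε
  have hε0 : 0 < ε := Real.rpow_pos_of_pos hn' _
  set D₀ : ℝ := p' ^ (2 * e₀) * (r : ℝ) ^ n / ((r : ℝ) ^ (2 * (v₀ - 1)) * q ^ e₀) * ε with hD₀
  have hD₀0 : 0 < D₀ := by positivity
  have hterm : ∀ φ ψ : V ↪ Fin n, (if 0 < overlap φ ψ then (weightedRandomGraph n β μ).real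
      (edgeEvent D (edgeImage Γ φ) ∩ edgeEvent D (edgeImage Γ ψ)) *
        ((patternColourings pat r φ ∩ patternColourings pat r ψ).card : ℝ) else 0) ≤
      D₀ * (n : ℝ) ^ overlap φ ψ := by
    intro φ ψ
    split_ifs with ho
    · rw [hP2]
      have hs : overlap φ ψ ≤ v₀ := Finset.card_le_univ _
      have hk := card_edgeImage_inter_le Γ hΓ φ ψ ho
      rw [Nat.card_eq_fintype_card] at hk
      have hke : (edgeImage Γ φ ∩ edgeImage Γ ψ).card ≤ e₀ :=
        (Finset.card_le_card Finset.inter_subset_left).trans (card_edgeImage Γ φ).le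
      refine le_trans ?_ (pair_term_le hv₀ hn0 hr hrn hq hq1 hβ hθ hθth h ho hs (by omega) hk hke)
      gcongr
      exact_mod_cast card_patternColourings_inter_le pat φ ψ ho
    · positivity
  set I : ℝ := (Fintype.card (V ↪ Fin n) : ℝ) with hI
  have hIge : ((n : ℝ) / 2) ^ v₀ ≤ I := half_pow_le_card_embedding hn
  have hI0 : 0 < I := lt_of_lt_of_le (by positivity) hIge
  have hsum : (I * p' ^ e₀ * ((t : ℝ) * (r : ℝ) ^ (n - v₀)) / (r : ℝ) ^ n) ^ 2 * E ≤
      I * (D₀ * ((v₀ + 1 : ℝ) * n) ^ v₀) := by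
    refine hsm.trans ?_
    calc _ ≤ ∑ φ : V ↪ Fin n, ∑ ψ : V ↪ Fin n, D₀ * (n : ℝ) ^ overlap φ ψ :=
          Finset.sum_le_sum fun φ _ => Finset.sum_le_sum fun ψ _ => hterm φ ψ
      _ ≤ ∑ φ : V ↪ Fin n, D₀ * ((v₀ + 1 : ℝ) * n) ^ v₀ := by
          refine Finset.sum_le_sum fun φ _ => ?_
          rw [← Finset.mul_sum]
          exact mul_le_mul_of_nonneg_left (sum_pow_overlap_le φ) hD₀0.le
      _ = _ := by rw [Finset.sum_const, Finset.card_univ, nsmul_eq_mul]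
  -- At least half of the shifts fit because `2 * L ≤ r`; squaring this loss gives the factor `4`.
  have htr : (r : ℝ) / 2 ≤ t := by
    have h1 : r - L ≤ t := sub_le_card_patternSet hL
    have h2 : r ≤ 2 * t := by omega
    have h3 : (r : ℝ) ≤ 2 * t := by exact_mod_cast h2
    linarith
  have hpow : (r : ℝ) ^ (n - v₀) * ((r : ℝ) ^ (v₀ - 1) * r) = (r : ℝ) ^ n := by
    rw [← pow_succ, ← pow_add]; congr 1; omega
  have hm : I * p' ^ e₀ / (2 * (r : ℝ) ^ (v₀ - 1)) ≤
      I * p' ^ e₀ * ((t : ℝ) * (r : ℝ) ^ (n - v₀)) / (r : ℝ) ^ n := by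
    rw [← hpow, div_le_div_iff₀ (by positivity) (by positivity)]
    calc I * p' ^ e₀ * ((r : ℝ) ^ (n - v₀) * ((r : ℝ) ^ (v₀ - 1) * r))
        = I * p' ^ e₀ * ((r : ℝ) ^ (n - v₀) * (2 * (r : ℝ) ^ (v₀ - 1))) * (r / 2) := by ring
      _ ≤ I * p' ^ e₀ * ((r : ℝ) ^ (n - v₀) * (2 * (r : ℝ) ^ (v₀ - 1))) * t := by gcongr
      _ = _ := by ring
  have hE0 : 0 ≤ E := Finset.sum_nonneg fun c _ => measureReal_nonneg
  have h1 : (I * p' ^ e₀ / (2 * (r : ℝ) ^ (v₀ - 1))) ^ 2 * E ≤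
      I * (D₀ * ((v₀ + 1 : ℝ) * n) ^ v₀) := by
    refine le_trans ?_ hsum
    gcongr
  -- The squared mean carries `I ^ 2`. One `I` cancels the sum over `φ`, the other beats `n ^ v₀`
  -- through `(n / 2) ^ v₀ ≤ I`, whence the `2 ^ v₀` in the constant.
  have h2 : I * E ≤ I * (4 * (2 * (v₀ + 1 : ℝ)) ^ v₀ / q ^ e₀ * ε * (r : ℝ) ^ n) := by
    refine le_of_mul_le_mul_left ?_
      (show 0 < I * (p' ^ (2 * e₀) / (4 * (r : ℝ) ^ (2 * (v₀ - 1)))) by positivity)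
    calc I * (p' ^ (2 * e₀) / (4 * (r : ℝ) ^ (2 * (v₀ - 1)))) * (I * E)
        = (I * p' ^ e₀ / (2 * (r : ℝ) ^ (v₀ - 1))) ^ 2 * E := by
          rw [mul_comm 2 e₀, mul_comm 2 (v₀ - 1), pow_mul, pow_mul]
          ring
      _ ≤ I * (D₀ * ((v₀ + 1 : ℝ) * n) ^ v₀) := h1
      _ = I * (D₀ * (2 * (v₀ + 1 : ℝ)) ^ v₀) * ((n : ℝ) / 2) ^ v₀ := by
          rw [show ((v₀ + 1 : ℝ) * n) = (2 * (v₀ + 1 : ℝ)) * ((n : ℝ) / 2) by ring, mul_pow]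
          ring
      _ ≤ I * (D₀ * (2 * (v₀ + 1 : ℝ)) ^ v₀) * I := by gcongr
      _ = _ := by
          rw [hD₀]
          field_simp
  exact le_of_mul_le_mul_left h2 hI0

/-! ### Good colourings and events about copies -/

/-- A copy of `Γ` with edge weights at most `d` that follows a `d`-separated pattern of diameter at
most `M` makes a colouring good. -/
theorem isGoodColouring_of_mem {n r : ℕ} {x : SimpleGraph (Fin n) × EdgeWeights n} {M d : ℝ}
    {pat : V → ℕ} (hpat : ∀ u v, u ≠ v → d ≤ |(pat u : ℝ) - pat v| ∧ |(pat u : ℝ) - pat v| ≤ M)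
    {c : Colouring n r} (φ : V ↪ Fin n) (hx : x ∈ edgeEvent (Set.Iic d) (edgeImage Γ φ))
    (hc : c ∈ patternColourings pat r φ) : IsGoodColouring Γ x.1 x.2 M c := by
  obtain ⟨G, w⟩ := x
  obtain ⟨hG, hw⟩ := hx
  simp only [Set.mem_ofPred_eq] at hG
  rw [Set.mem_univ_pi] at hw
  let f : SimpleGraph.Copy Γ G :=
    ⟨⟨φ, fun {u v} huv => (edgeImage_subset_iff Γ φ G).1 hG u v huv⟩, φ.injective⟩
  refine ⟨f.toSubgraph, ⟨f.isoToSubgraph.symm⟩, ?_⟩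
  intro a b hab
  obtain ⟨u, v, huv, rfl, rfl⟩ : ∃ u v, Γ.Adj u v ∧ φ u = a ∧ φ v = b := by
    simpa [SimpleGraph.Copy.toSubgraph, Relation.Map, f] using hab
  simp only [patternColourings, Finset.mem_filter, Finset.mem_univ, true_and, mem_patternSet,
    Function.comp_apply] at hc
  obtain ⟨s, hs⟩ := hc
  have hdist : colourDist c (φ u) (φ v) = |(pat u : ℝ) - pat v| := by
    rw [colourDist, hs u, hs v]
    push_cast
    congr 1
    ring
  rw [hdist]
  obtain ⟨h1, h2⟩ := hpat u v huv.ne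
  exact ⟨(hw _ (mk_mem_edgeImage Γ φ huv)).trans h1, h2⟩

open Classical in
/-- The colourings for which the ends of the edges of the copy of `Γ` along `φ` have colours at
distance at most `M`. -/
noncomputable def closeColourings {n : ℕ} (M : ℝ) (r : ℕ) (φ : V ↪ Fin n) :
    Finset (Colouring n r) :=
  Finset.univ.filter fun c => ∀ u v, Γ.Adj u v → colourDist c (φ u) (φ v) ≤ M

/-- The upper bound needs only the condition with `M`; the weight condition is discarded by taking
`D = univ`. -/
theorem exists_of_isGoodColouring {n r : ℕ} {x : SimpleGraph (Fin n) × EdgeWeights n} {M : ℝ}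
    {c : Colouring n r} (h : IsGoodColouring Γ x.1 x.2 M c) :
    ∃ φ : V ↪ Fin n, x ∈ edgeEvent Set.univ (edgeImage Γ φ) ∧ c ∈ closeColourings Γ M r φ := by
  obtain ⟨T, ⟨e⟩, hT⟩ := h
  have hadj : ∀ u v, Γ.Adj u v → T.Adj (e.symm u).1 (e.symm v).1 := fun u v huv =>
    e.symm.map_adj_iff.2 huv
  refine ⟨⟨fun v => (e.symm v).1, fun u v huv => e.symm.injective (Subtype.ext huv)⟩, ?_, ?_⟩
  · refine ⟨?_, by simp⟩
    exact (edgeImage_subset_iff Γ _ _).2 fun u v huv => T.adj_sub (hadj u v huv)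
  · simp only [closeColourings, Finset.mem_filter, Finset.mem_univ, true_and]
    exact fun u v huv => (hT _ _ (hadj u v huv)).2

/-! ### First moment estimate above the threshold -/

theorem abs_sub_le_length_mul {V : Type*} {Γ : SimpleGraph V} (f : V → ℝ) {M : ℝ}
    (hf : ∀ u v, Γ.Adj u v → |f u - f v| ≤ M) {u v : V} (p : Γ.Walk u v) :
    |f u - f v| ≤ p.length * M := by
  induction p with
  | nil => simp
  | @cons u v w h p ih =>
    rw [SimpleGraph.Walk.length_cons]
    push_cast
    calc |f u - f w| ≤ |f u - f v| + |f v - f w| := abs_sub_le _ _ _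
      _ ≤ M + p.length * M := add_le_add (hf u v h) ih
      _ = _ := by ring

/-- Fix a root. A path to it has fewer than `v₀` edges, so every colour on the copy is within `v₀ *
⌈M⌉₊` of the root's. The root colour and the vector of offsets determine all colours on the copy. -/
theorem card_closeColourings_le (hΓ : Γ.Connected) {M : ℝ} (hM : 0 ≤ M) {n r : ℕ}
    (φ : V ↪ Fin n) :
    (closeColourings Γ M r φ).card ≤
      r * (2 * (Fintype.card V * ⌈M⌉₊) + 1) ^ Fintype.card V * r ^ (n - Fintype.card V) := by
  classical
  obtain ⟨v₁⟩ := hΓ.nonempty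
  set L : ℕ := Fintype.card V * ⌈M⌉₊ with hL
  have := card_le_of_determined (closeColourings Γ M r φ) (Finset.univ.map φ)
    (fun c => (c (φ v₁), fun v => ((c (φ v) : ℕ) : ℤ) - ((c (φ v₁) : ℕ) : ℤ)))
    ((Finset.univ : Finset (Finset.Icc 1 r)) ×ˢ
      Fintype.piFinset fun _ : V => Finset.Icc (-(L : ℤ)) L) (by
      intro c hc
      simp only [closeColourings, Finset.mem_filter, Finset.mem_univ, true_and] at hc
      refine Finset.mem_product.2 ⟨Finset.mem_univ _, Fintype.mem_piFinset.2 fun v => ?_⟩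
      obtain ⟨p⟩ := hΓ.preconnected v v₁
      have h1 := abs_sub_le_length_mul (fun v => ((c (φ v) : ℕ) : ℝ)) hc p.toPath.1
      have h2 : (p.toPath.1.length : ℝ) ≤ Fintype.card V := by
        exact_mod_cast p.toPath.2.length_lt.le
      have h3 : |((c (φ v) : ℕ) : ℝ) - ((c (φ v₁) : ℕ) : ℝ)| ≤ L := by
        refine h1.trans ?_
        rw [hL]
        push_cast
        have := Nat.le_ceil M
        gcongr
      rw [Finset.mem_Icc, ← abs_le]
      exact_mod_cast h3) (by
      intro c _ c' _ hcc i hi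
      obtain ⟨v, -, rfl⟩ := Finset.mem_map.1 hi
      simp only [Prod.mk.injEq] at hcc
      have h1 := congrFun hcc.2 v
      simp only [hcc.1] at h1
      exact Subtype.ext (by omega))
  simp only [Finset.card_product, Finset.card_univ, Fintype.card_coe, Nat.card_Icc,
    Nat.add_sub_cancel, Fintype.card_piFinset, Finset.prod_const, Int.card_Icc, Finset.card_map,
    Fintype.card_fin] at this
  have e : ((L : ℤ) + 1 - -(L : ℤ)).toNat = 2 * L + 1 := by omega
  rwa [e] at this

/-- The weighted graphs that contain a copy of `Γ` with close colours on its edges. -/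
def closeCopyEvent (M : ℝ) {n r : ℕ} (c : Colouring n r) :
    Set (SimpleGraph (Fin n) × EdgeWeights n) :=
  ⋃ φ : V ↪ Fin n, {x | x ∈ edgeEvent Set.univ (edgeImage Γ φ) ∧ c ∈ closeColourings Γ M r φ}

theorem measurableSet_closeCopyEvent (M : ℝ) {n r : ℕ} (c : Colouring n r) :
    MeasurableSet (closeCopyEvent Γ M c) := by
  refine MeasurableSet.iUnion fun φ => ?_
  have hm := (weightedRandomGraph_real_edgeEvent (β := 1) one_pos (Measure.dirac 0)
    MeasurableSet.univ (edgeImage Γ φ) fun e he => not_isDiag_of_mem_edgeImage Γ he).1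
  by_cases hc : c ∈ closeColourings Γ M r φ
  · simp only [hc, and_true]
    exact hm
  · simp [hc]

/-- A union bound over at most `n ^ v₀` embeddings, each with edge probability `n ^ (-β * e₀)` and a
fraction `O(r ^ (-(v₀ - 1)))` of close colourings. The power of `2` comes from `n ^ θ / 2 ≤ r`. -/
theorem sum_measureReal_closeCopyEvent_le (hΓ : Γ.Connected) {M : ℝ} (hM : 0 ≤ M)
    (μ : Measure ℝ) [IsProbabilityMeasure μ] {β θ θth : ℝ} (hβ : 0 < β)
    (hθth : θth * ((Fintype.card V : ℝ) - 1) = Fintype.card V - Γ.edgeSet.ncard * β) {n r : ℕ}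
    (hn : 0 < n) (hnV : Fintype.card V ≤ n) (hr : 0 < r) (hrn : (n : ℝ) ^ θ / 2 ≤ r) :
    ∑ c : Colouring n r, (weightedRandomGraph n β μ).real (closeCopyEvent Γ M c) ≤
      (2 * (Fintype.card V * ⌈M⌉₊) + 1 : ℝ) ^ Fintype.card V * 2 ^ (Fintype.card V - 1) *
        (n : ℝ) ^ (-((θ - θth) * ((Fintype.card V : ℝ) - 1))) * (r : ℝ) ^ n := by
  classical
  have hprob : IsProbabilityMeasure (weightedRandomGraph n β μ) := by
    unfold weightedRandomGraph; infer_instance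
  have hn' : (0 : ℝ) < n := by exact_mod_cast hn
  have hr' : (0 : ℝ) < r := by exact_mod_cast hr
  have hV : 0 < Fintype.card V := Fintype.card_pos_iff.2 hΓ.nonempty
  set v₀ := Fintype.card V with hv₀def
  set e₀ := Γ.edgeSet.ncard with he₀def
  set Λ : ℝ := (2 * (v₀ * ⌈M⌉₊) + 1 : ℝ) ^ v₀ with hΛ
  set p : ℝ := (n : ℝ) ^ (-β) with hp
  have hp0 : 0 < p := Real.rpow_pos_of_pos hn' _
  have hle : ∀ c : Colouring n r, (weightedRandomGraph n β μ).real (closeCopyEvent Γ M c) ≤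
      ∑ φ : V ↪ Fin n, p ^ e₀ * (if c ∈ closeColourings Γ M r φ then 1 else 0) := by
    intro c
    refine (measureReal_iUnion_fintype_le _).trans (Finset.sum_le_sum fun φ _ => ?_)
    have hm := (weightedRandomGraph_real_edgeEvent hβ μ MeasurableSet.univ (edgeImage Γ φ)
      fun e he => not_isDiag_of_mem_edgeImage Γ he).2
    rw [card_edgeImage, probReal_univ, mul_one] at hm
    by_cases hc : c ∈ closeColourings Γ M r φ
    · simp only [hc, and_true, if_true, mul_one]
      exact hm.le
    · simp [hc]
  have hpow : (r : ℝ) * (r : ℝ) ^ (n - v₀) * (r : ℝ) ^ (v₀ - 1) = (r : ℝ) ^ n := by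
    rw [← pow_succ', ← pow_add]; congr 1; omega
  have hrpow : (r : ℝ) * (r : ℝ) ^ (n - v₀) ≤
      (r : ℝ) ^ n * 2 ^ (v₀ - 1) * (n : ℝ) ^ (-(θ * ((v₀ : ℝ) - 1))) := by
    have h1 : 1 ≤ (r : ℝ) ^ (v₀ - 1) * (2 ^ (v₀ - 1) * (n : ℝ) ^ (-(θ * ((v₀ : ℝ) - 1)))) := by
      rw [Real.rpow_neg hn'.le, Real.rpow_mul hn'.le, ← Nat.cast_pred hV, Real.rpow_natCast,
        ← mul_assoc, ← mul_pow, ← div_eq_mul_inv, ← div_pow]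
      refine one_le_pow₀ ?_
      rw [one_le_div (Real.rpow_pos_of_pos hn' _)]
      linarith
    calc (r : ℝ) * (r : ℝ) ^ (n - v₀) = (r : ℝ) * (r : ℝ) ^ (n - v₀) * 1 := by ring
      _ ≤ (r : ℝ) * (r : ℝ) ^ (n - v₀) *
          ((r : ℝ) ^ (v₀ - 1) * (2 ^ (v₀ - 1) * (n : ℝ) ^ (-(θ * ((v₀ : ℝ) - 1))))) := by gcongr
      _ = _ := by rw [← hpow]; ring
  have hcard : ∀ φ : V ↪ Fin n, ((closeColourings Γ M r φ).card : ℝ) ≤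
      Λ * ((r : ℝ) ^ n * 2 ^ (v₀ - 1) * (n : ℝ) ^ (-(θ * ((v₀ : ℝ) - 1)))) := by
    intro φ
    calc ((closeColourings Γ M r φ).card : ℝ) ≤ r * Λ * (r : ℝ) ^ (n - v₀) := by
          rw [hΛ]
          exact_mod_cast card_closeColourings_le Γ hΓ hM φ
      _ = Λ * ((r : ℝ) * (r : ℝ) ^ (n - v₀)) := by ring
      _ ≤ _ := by gcongr
  calc ∑ c : Colouring n r, (weightedRandomGraph n β μ).real (closeCopyEvent Γ M c)
      ≤ ∑ c : Colouring n r, ∑ φ : V ↪ Fin n,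
          p ^ e₀ * (if c ∈ closeColourings Γ M r φ then 1 else 0) :=
        Finset.sum_le_sum fun c _ => hle c
    _ = ∑ φ : V ↪ Fin n, p ^ e₀ * ((closeColourings Γ M r φ).card : ℝ) := by
        rw [Finset.sum_comm]
        refine Finset.sum_congr rfl fun φ _ => ?_
        rw [← Finset.mul_sum]
        simp
    _ ≤ ∑ φ : V ↪ Fin n, p ^ e₀ *
          (Λ * ((r : ℝ) ^ n * 2 ^ (v₀ - 1) * (n : ℝ) ^ (-(θ * ((v₀ : ℝ) - 1))))) := by
        gcongr with φ _
        exact hcard φ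
    _ = Fintype.card (V ↪ Fin n) * (p ^ e₀ *
          (Λ * ((r : ℝ) ^ n * 2 ^ (v₀ - 1) * (n : ℝ) ^ (-(θ * ((v₀ : ℝ) - 1)))))) := by
        rw [Finset.sum_const, Finset.card_univ, nsmul_eq_mul]
    _ ≤ (n : ℝ) ^ v₀ * (p ^ e₀ *
          (Λ * ((r : ℝ) ^ n * 2 ^ (v₀ - 1) * (n : ℝ) ^ (-(θ * ((v₀ : ℝ) - 1)))))) := by
        gcongr
        exact card_embedding_le
    _ = Λ * 2 ^ (v₀ - 1) * ((n : ℝ) ^ v₀ * p ^ e₀ * (n : ℝ) ^ (-(θ * ((v₀ : ℝ) - 1)))) *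
          (r : ℝ) ^ n := by ring
    _ = _ := by
        congr 2
        rw [hp, ← Real.rpow_natCast _ v₀, ← Real.rpow_natCast _ e₀, ← Real.rpow_mul hn'.le,
          ← Real.rpow_add hn', ← Real.rpow_add hn']
        congr 1
        linear_combination (-1 : ℝ) * hθth

/-! ### Choice of constants and conclusion -/

/-- For large `n` the number of colours is of order `n ^ θ`. -/
theorem eventually_numColours {θ : ℝ} (hθ : 0 < θ) (m : ℕ) :
    ∀ᶠ n : ℕ in Filter.atTop, m ≤ numColours θ n ∧ (numColours θ n : ℝ) ≤ (n : ℝ) ^ θ ∧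
      (n : ℝ) ^ θ / 2 ≤ numColours θ n := by
  have h := (tendsto_rpow_atTop hθ).comp tendsto_natCast_atTop_atTop
  filter_upwards [h.eventually_ge_atTop (m : ℝ), h.eventually_ge_atTop 1] with n h1 h2
  simp only [Function.comp_apply] at h1 h2
  refine ⟨Nat.le_floor h1, Nat.floor_le (by linarith), ?_⟩
  have h3 := Nat.lt_floor_add_one ((n : ℝ) ^ θ)
  have h4 : (1 : ℝ) ≤ (⌊(n : ℝ) ^ θ⌋₊ : ℝ) := by exact_mod_cast Nat.le_floor (by simpa using h2)
  rw [numColours]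
  linarith

/-- These half-lines exhaust `ℝ`. The bound is a natural number so that it can space integer
colours, and positive so that `M₀ > 0`. -/
theorem exists_measureReal_Iic_pos (μ : Measure ℝ) [IsProbabilityMeasure μ] :
    ∃ d : ℕ, 0 < d ∧ 0 < μ.real (Set.Iic (d : ℝ)) := by
  by_contra! hcon
  have h0 : ∀ d : ℕ, μ (Set.Iic ((d + 1 : ℕ) : ℝ)) = 0 := fun d =>
    (measureReal_eq_zero_iff).1 (le_antisymm (hcon (d + 1) d.succ_pos) measureReal_nonneg)
  have h1 : (⋃ d : ℕ, Set.Iic ((d + 1 : ℕ) : ℝ)) = Set.univ := by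
    refine Set.eq_univ_of_forall fun x => Set.mem_iUnion.2 ⟨⌈x⌉₊, ?_⟩
    have := Nat.le_ceil x
    simp only [Set.mem_Iic]
    push_cast
    linarith
  have h2 : μ Set.univ = 0 := by rw [← h1]; exact measure_iUnion_null h0
  simp at h2

/-- Enumerate the vertices and give the `i`-th one the value `i * d`. -/
theorem exists_separated_pattern (V : Type*) [Fintype V] (d : ℕ) :
    ∃ pat : V → ℕ, (∀ v, pat v ≤ Fintype.card V * d) ∧ ∀ u v, u ≠ v →
      (d : ℝ) ≤ |(pat u : ℝ) - pat v| ∧ |(pat u : ℝ) - pat v| ≤ Fintype.card V * d := by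
  let e := Fintype.equivFin V
  have hle : ∀ v, (e v : ℕ) * d ≤ Fintype.card V * d := fun v =>
    Nat.mul_le_mul_right d (e v).2.le
  refine ⟨fun v => e v * d, hle, fun u v huv => ⟨?_, ?_⟩⟩
  · have h1 : (e u : ℕ) ≠ e v := fun h => huv (e.injective (Fin.ext h))
    have h2 : (1 : ℤ) ≤ |((e u : ℕ) : ℤ) - (e v : ℕ)| := Int.one_le_abs (by omega)
    have h3 : (1 : ℝ) ≤ |((e u : ℕ) : ℝ) - (e v : ℕ)| := by exact_mod_cast h2
    push_cast
    rw [← sub_mul, abs_mul, Nat.abs_cast]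
    exact le_mul_of_one_le_left (Nat.cast_nonneg d) h3
  · have h1 : ((e u * d : ℕ) : ℝ) ≤ Fintype.card V * d := by exact_mod_cast hle u
    have h2 : ((e v * d : ℕ) : ℝ) ≤ Fintype.card V * d := by exact_mod_cast hle v
    have h3 : (0 : ℝ) ≤ ((e u * d : ℕ) : ℝ) := Nat.cast_nonneg _
    have h4 : (0 : ℝ) ≤ ((e v * d : ℕ) : ℝ) := Nat.cast_nonneg _
    rw [abs_le]
    constructor <;> linarith

theorem two_le_card_of_edgeSet_ncard_pos (h : 0 < Γ.edgeSet.ncard) : 2 ≤ Fintype.card V := by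
  obtain ⟨e, he⟩ := Set.nonempty_of_ncard_ne_zero h.ne'
  induction e with
  | _ u v =>
    have : Nontrivial V := ⟨u, v, SimpleGraph.Adj.ne (by simpa using he)⟩
    exact Fintype.one_lt_card

end LocallyCorrect

open LocallyCorrect in
theorem theorem2 {V : Type*} [Fintype V] (Γ : SimpleGraph V) (hΓ : IsBalanced Γ)
    (v₀ e₀ : ℕ) (hv₀ : v₀ = Nat.card V) (he₀ : e₀ = Γ.edgeSet.ncard) (he₀_pos : 0 < e₀)
    (μ : Measure ℝ) [IsProbabilityMeasure μ]
    (θ β θth : ℝ) (hθ_pos : 0 < θ) (hθ_lt : θ < 1)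
    (hβ_gt : 1 / (e₀ : ℝ) < β) (hβ_lt : β < (v₀ : ℝ) / (e₀ : ℝ))
    (hθth : θth = ((v₀ : ℝ) - (e₀ : ℝ) * β) / ((v₀ : ℝ) - 1)) :
    (0 < θth ∧ θth < 1) ∧
    ∃ M₀ : ℝ, 0 < M₀ ∧ ∀ M : ℝ, M₀ < M →
      (θ < θth →
        ∃ C₁ C₂ : ℝ, 0 < C₁ ∧ 0 < C₂ ∧ ∃ N : ℕ, ∀ n : ℕ, N ≤ n →
          1 - 1 / (n : ℝ) ^ C₂ ≤
            (weightedRandomGraph n β μ).real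
              {x | (numColourings n (numColours θ n) : ℝ) * (1 - 1 / (n : ℝ) ^ C₁) ≤
                (numGoodColourings Γ (numColours θ n) M x.1 x.2 : ℝ)}) ∧
      (Γ.Connected → θth < θ →
        ∃ D₁ D₂ : ℝ, 0 < D₁ ∧ 0 < D₂ ∧ ∃ N : ℕ, ∀ n : ℕ, N ≤ n →
          1 - 1 / (n : ℝ) ^ D₂ ≤
            (weightedRandomGraph n β μ).real
              {x | (numGoodColourings Γ (numColours θ n) M x.1 x.2 : ℝ) ≤
                (numColourings n (numColours θ n) : ℝ) / (n : ℝ) ^ D₁}) := by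
  have hprob : ∀ n, IsProbabilityMeasure (weightedRandomGraph n β μ) := fun n => by
    unfold weightedRandomGraph; infer_instance
  subst hv₀ he₀
  rw [Nat.card_eq_fintype_card] at *
  have hv₀ : 2 ≤ Fintype.card V := two_le_card_of_edgeSet_ncard_pos Γ he₀_pos
  have hv₀' : (2 : ℝ) ≤ Fintype.card V := by exact_mod_cast hv₀
  have he₀' : (0 : ℝ) < Γ.edgeSet.ncard := by exact_mod_cast he₀_pos
  have hβ : 0 < β := lt_trans (by positivity) hβ_gt
  have hv₁ : (0 : ℝ) < (Fintype.card V : ℝ) - 1 := by linarith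
  have hth : θth * ((Fintype.card V : ℝ) - 1) = Fintype.card V - Γ.edgeSet.ncard * β := by
    rw [hθth, div_mul_cancel₀ _ hv₁.ne']
  rw [div_lt_iff₀ he₀'] at hβ_gt
  rw [lt_div_iff₀ he₀'] at hβ_lt
  refine ⟨⟨by rw [hθth]; exact div_pos (by linarith) hv₁,
    by rw [hθth, div_lt_one hv₁]; linarith⟩, ?_⟩
  obtain ⟨d, hd, hq⟩ := exists_measureReal_Iic_pos μ
  obtain ⟨pat, hpat, hsep⟩ := exists_separated_pattern V d
  have hcardC : ∀ n, (Fintype.card (Colouring n (numColours θ n)) : ℝ) =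
      (numColours θ n : ℝ) ^ n := by simp
  have hlarge : ∀ {K δ : ℝ}, 0 < δ → ∀ᶠ n : ℕ in Filter.atTop, K ≤ (n : ℝ) ^ (δ / 2) :=
    fun hδ => ((tendsto_rpow_atTop (half_pos hδ)).comp
      tendsto_natCast_atTop_atTop).eventually_ge_atTop _
  -- `M₀` is the bound on the diameter of the pattern; only part (a) needs `M` to be this large.
  refine ⟨Fintype.card V * d, by positivity, fun M hM => ⟨fun hθ => ?_, fun hconn hθ => ?_⟩⟩
  · set δ := (θth - θ) / 2 with hδ
    have hδ0 : 0 < δ := by rw [hδ]; linarith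
    set K : ℝ := 4 * (2 * (Fintype.card V + 1 : ℝ)) ^ Fintype.card V /
      μ.real (Set.Iic (d : ℝ)) ^ Γ.edgeSet.ncard
    refine ⟨δ / 4, δ / 4, by linarith, by linarith, ?_⟩
    rw [← Filter.eventually_atTop]
    -- This many colours ensure both `r > 0` and `2 * L ≤ r` with `L = v₀ * d`.
    filter_upwards [eventually_numColours hθ_pos (2 * (Fintype.card V * d) + 1),
      hlarge (K := K) hδ0, Filter.eventually_ge_atTop (2 * Fintype.card V)]
      with n ⟨hr1, hr2, hr3⟩ hK hn
    have hr : 0 < numColours θ n := by omega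
    have : Nonempty (Colouring n (numColours θ n)) :=
      ⟨fun _ => ⟨1, Finset.mem_Icc.2 ⟨le_rfl, hr⟩⟩⟩
    have hsum := sum_measureReal_noPatternEvent_le Γ hΓ hv₀ μ measurableSet_Iic hq hβ hθ_pos hth hθ
      hpat hn hr (by omega) hr2
    rw [← hcardC] at hsum
    refine (one_sub_le_measureReal_card_le _ _
      (fun c => measurableSet_noPatternEvent Γ measurableSet_Iic pat c) (by omega) hK hsum).trans ?_
    refine measureReal_mono fun x hx => ?_
    simp only [Set.mem_ofPred_eq] at hx ⊢
    have hgood : Fintype.card (Colouring n (numColours θ n)) ≤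
        Nat.card {c : Colouring n (numColours θ n) //
          x ∈ noPatternEvent Γ (Set.Iic (d : ℝ)) pat c} +
        numGoodColourings Γ (numColours θ n) M x.1 x.2 := by
      classical
      rw [numGoodColourings, Nat.card_eq_fintype_card, Nat.card_eq_fintype_card,
        Fintype.card_subtype, Fintype.card_subtype, ← Finset.card_univ]
      refine (Finset.card_le_card fun c _ => ?_).trans (Finset.card_union_le _ _)
      simp only [Finset.mem_union, Finset.mem_filter, Finset.mem_univ, true_and]
      by_cases hc : x ∈ noPatternEvent Γ (Set.Iic (d : ℝ)) pat c
      · exact Or.inl hc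
      · right
        obtain ⟨φ, h1, h2⟩ := by
          simpa only [noPatternEvent, Set.mem_ofPred_eq, not_forall, not_not] using hc
        exact isGoodColouring_of_mem Γ
          (fun u v huv => ⟨(hsep u v huv).1, (hsep u v huv).2.trans hM.le⟩) φ h1 h2
    have hgood' : (Fintype.card (Colouring n (numColours θ n)) : ℝ) ≤
        Nat.card {c : Colouring n (numColours θ n) //
          x ∈ noPatternEvent Γ (Set.Iic (d : ℝ)) pat c} +
        numGoodColourings Γ (numColours θ n) M x.1 x.2 := by exact_mod_cast hgood
    rw [numColourings, Nat.card_eq_fintype_card, mul_sub, mul_one, mul_one_div]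
    linarith
  · set δ := (θ - θth) * ((Fintype.card V : ℝ) - 1) with hδ
    have hδ0 : 0 < δ := mul_pos (by linarith) hv₁
    have hM0 : 0 ≤ M := le_trans (by positivity) hM.le
    set K : ℝ := (2 * (Fintype.card V * ⌈M⌉₊) + 1 : ℝ) ^ Fintype.card V *
      2 ^ (Fintype.card V - 1)
    refine ⟨δ / 4, δ / 4, by linarith, by linarith, ?_⟩
    rw [← Filter.eventually_atTop]
    filter_upwards [eventually_numColours hθ_pos 1, hlarge (K := K) hδ0,
      Filter.eventually_ge_atTop (Fintype.card V)] with n ⟨hr, hr2, hr3⟩ hK hn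
    have : Nonempty (Colouring n (numColours θ n)) :=
      ⟨fun _ => ⟨1, Finset.mem_Icc.2 ⟨le_rfl, hr⟩⟩⟩
    have hsum := sum_measureReal_closeCopyEvent_le Γ hconn hM0 μ hβ hth (by omega) hn hr hr3
    rw [← hcardC] at hsum
    refine (one_sub_le_measureReal_card_le _ _
      (fun c => measurableSet_closeCopyEvent Γ M c) (by omega) hK hsum).trans ?_
    refine measureReal_mono fun x hx => ?_
    simp only [Set.mem_ofPred_eq] at hx ⊢
    rw [numColourings, Nat.card_eq_fintype_card]
    refine le_trans ?_ hx
    rw [numGoodColourings]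
    refine Nat.cast_le.2 (Nat.card_le_card_of_injective
      (Subtype.map id fun c hc => ?_) (Subtype.map_injective _ Function.injective_id))
    obtain ⟨φ, h1, h2⟩ := exists_of_isGoodColouring Γ hc
    exact Set.mem_iUnion.2 ⟨φ, h1, h2⟩
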